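/- Let $M_{r,s}$ denote the complex $r\times s$ matrices, $M_r=M_{r,r}$, all with the operator norm, and let $\varphi : M_n\to M_k$ be a linear map with $\|\varphi\|_{cb}=\sup_{m\ge 1}\|\mathrm{id}_m\otimes\varphi\|$. For $u\in M_{k,n}\otimes M_{n,k}$ let $$\|u\|_h=\inf\Big\{\big\|\textstyle\sum_i A_iA_i^*\big\|^{1/2}\big\|\sum_i B_i^*B_i\big\|^{1/2}\Big\},$$ the infimum being over all representations $u=\sum_i A_i\otimes B_i$ as a finite sum of elementary tensors. (1) Let $\varphi(X)=\sum_{i=1}^m A_iXB_i$ with $A_i\in M_{k,n}$, $B_i\in M_{n,k}$. Let $C_1,\dots,C_l$ be a basis of $\mathrm{span}\{B_i\}$, write $B_i=\sum_j d_{i,j}C_j$, and put $D_j=\sum_i d_{i,j}A_i$. Let $E_1,\dots,E_p$ be a basis of $\mathrm{span}\{D_j\}$, write $D_j=\sum_i e_{j,i}E_i$, and put $F_i=\sum_j e_{j,i}C_j$. Then $\varphi(X)=\sum_{i=1}^pE_iXF_i$, and the families $(E_i)$ and $(F_i)$ are each linearly independent. (2) Let $\varphi(X)=\sum_{i=1}^pE_iXF_i$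 be any representation with $E_i\in M_{k,n}$, $F_i\in M_{n,k}$ such that $(E_i)$ and $(F_i)$ are each linearly independent. For an invertible $S=(s_{i,j})\in M_p$ with inverse $S^{-1}=(t_{i,j})$ put $H_i=\sum_j s_{i,j}F_j$ and $G_j=\sum_i t_{i,j}E_i$. Then $$\|\varphi\|_{cb}=\inf_S\ \big\|\textstyle\sum_i G_iG_i^*\big\|^{1/2}\big\|\sum_i H_i^*H_i\big\|^{1/2},$$ where the infimum is over all invertible $S\in M_p$, and the same equality holds with the infimum over all positive invertible $S\in M_p$. Moreover, with $u=\sum_{i=1}^pE_i\otimes F_i$, one has $\|u\|_h=\|\varphi\|_{cb}$, the number $p$ is the least length of a representation of $u$ as a sum of elementary tensors, and the infimum defining $\|u\|_h$ is attained at a representation of this minimal length: for some positive invertible $S$, $u=\sum_{i=1}^pG_i\otimes H_i$ and $\|u\|_h=\|\sum_i G_iG_i^*\|^{1/2}\|\sum_i H_i^*H_i\|^{1/2}$. -/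

import Mathlib

open scoped TensorProduct ENNReal ComplexOrder Matrix.Norms.L2Operator

namespace CBNorm

/-- The amplification `id_m ⊗ φ : M_m(M_n) → M_m(M_k)`, which applies `φ` to each block of an
`m × m` block matrix. Block matrices are flattened to matrices with index set `Fin m × Fin n`,
that is, to operators on the `m`-fold direct sum of the underlying Euclidean space. -/
def amplification {n k : ℕ}
    (φ : Matrix (Fin n) (Fin n) ℂ →ₗ[ℂ] Matrix (Fin k) (Fin k) ℂ) (m : ℕ)
    (X : Matrix (Fin m × Fin n) (Fin m × Fin n) ℂ) :
    Matrix (Fin m × Fin k) (Fin m × Fin k) ℂ :=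
  Matrix.comp (Fin m) (Fin m) (Fin k) (Fin k) ℂ
    (((Matrix.comp (Fin m) (Fin m) (Fin n) (Fin n) ℂ).symm X).map φ)

/-- The completely bounded norm `sup_{m ≥ 1} ‖id_m ⊗ φ‖`, where
`‖id_m ⊗ φ‖ = sup {‖(id_m ⊗ φ)(X)‖ : ‖X‖ ≤ 1}` and matrices carry the operator norm. The supremum
is taken in `[0, ∞]`. -/
noncomputable def cbNorm {n k : ℕ}
    (φ : Matrix (Fin n) (Fin n) ℂ →ₗ[ℂ] Matrix (Fin k) (Fin k) ℂ) : ℝ≥0∞ :=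
  ⨆ (m : ℕ) (_ : 1 ≤ m), ⨆ (X : Matrix (Fin m × Fin n) (Fin m × Fin n) ℂ) (_ : ‖X‖ ≤ 1),
    ‖amplification φ m X‖ₑ

/-- `φ(X) = ∑ i, A i * X * B i`: a generalized Choi-Kraus representation of `φ`. -/
def IsChoiKraus {n k m : ℕ}
    (φ : Matrix (Fin n) (Fin n) ℂ →ₗ[ℂ] Matrix (Fin k) (Fin k) ℂ)
    (A : Fin m → Matrix (Fin k) (Fin n) ℂ) (B : Fin m → Matrix (Fin n) (Fin k) ℂ) : Prop :=
  ∀ X : Matrix (Fin n) (Fin n) ℂ, φ X = ∑ i, A i * X * B i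

/-- `‖∑ i, A i * (A i)*‖^{1/2} * ‖∑ i, (B i)* * B i‖^{1/2}`, with the operator norm. -/
noncomputable def cost {n k m : ℕ}
    (A : Fin m → Matrix (Fin k) (Fin n) ℂ) (B : Fin m → Matrix (Fin n) (Fin k) ℂ) : ℝ≥0∞ :=
  ‖∑ i, A i * (A i).conjTranspose‖ₑ ^ (1 / 2 : ℝ) *
    ‖∑ i, (B i).conjTranspose * B i‖ₑ ^ (1 / 2 : ℝ)

/-- The Haagerup tensor norm on `M_{k,n} ⊗ M_{n,k}`: the infimum of the cost over all ways of
writing `u` as a finite sum of elementary tensors. -/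
noncomputable def haagerupNorm {n k : ℕ}
    (u : Matrix (Fin k) (Fin n) ℂ ⊗[ℂ] Matrix (Fin n) (Fin k) ℂ) : ℝ≥0∞ :=
  ⨅ (m : ℕ) (A : Fin m → Matrix (Fin k) (Fin n) ℂ) (B : Fin m → Matrix (Fin n) (Fin k) ℂ)
    (_ : u = ∑ i, A i ⊗ₜ[ℂ] B i), cost A B

/-- `H_i = ∑ j, s_{i,j} F_j` for `S = (s_{i,j})`. -/
def leftMix {n k p : ℕ} (S : Matrix (Fin p) (Fin p) ℂ)
    (F : Fin p → Matrix (Fin n) (Fin k) ℂ) : Fin p → Matrix (Fin n) (Fin k) ℂ :=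
  fun i => ∑ j, S i j • F j

/-- `G_j = ∑ i, t_{i,j} E_i` for `T = (t_{i,j})`. -/
def rightMix {n k p : ℕ} (E : Fin p → Matrix (Fin k) (Fin n) ℂ)
    (T : Matrix (Fin p) (Fin p) ℂ) : Fin p → Matrix (Fin k) (Fin n) ℂ :=
  fun j => ∑ i, T i j • E i

/-- `(E, F)` is obtained from `(A, B)` by eliminating linear dependencies: first choose a basis `C`
of the span of the `B i`, with `B i = ∑ j, d i j • C j`, and set `D j = ∑ i, d i j • A i`; then
choose a basis `E` of the span of the `D j`, with `D j = ∑ i, e j i • E i`, and set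
`F i = ∑ j, e j i • C j`. -/
def IsReduction {n k m p : ℕ}
    (A : Fin m → Matrix (Fin k) (Fin n) ℂ) (B : Fin m → Matrix (Fin n) (Fin k) ℂ)
    (E : Fin p → Matrix (Fin k) (Fin n) ℂ) (F : Fin p → Matrix (Fin n) (Fin k) ℂ) : Prop :=
  ∃ (l : ℕ) (C : Fin l → Matrix (Fin n) (Fin k) ℂ) (D : Fin l → Matrix (Fin k) (Fin n) ℂ)
    (d : Matrix (Fin m) (Fin l) ℂ) (e : Matrix (Fin l) (Fin p) ℂ),
    LinearIndependent ℂ C ∧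
    Submodule.span ℂ (Set.range C) = Submodule.span ℂ (Set.range B) ∧
    (∀ i, B i = ∑ j, d i j • C j) ∧
    (∀ j, D j = ∑ i, d i j • A i) ∧
    LinearIndependent ℂ E ∧
    Submodule.span ℂ (Set.range E) = Submodule.span ℂ (Set.range D) ∧
    (∀ j, D j = ∑ i, e j i • E i) ∧
    (∀ i, F i = ∑ j, e j i • C j)

end CBNorm

namespace CBNorm

open Matrix
open scoped MatrixOrder Kronecker

variable {n k p m : ℕ}

/-! Cauchy–Schwarz for a row times `1 ⊗ X` times a column bounds the cb norm by the cost of any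
representation, and every representation of the tensor induces the same map. So everything reduces
to finding one positive invertible `S` whose cost is at most the cb norm
(`exists_posDef_cost_le_cbNorm`).

Put `a = E`, `b i = (F i)ᴴ`, and minimize `max ‖quad a P⁻¹‖ ‖quad b P‖` over positive definite `P`.
Linear independence makes this coercive, so a minimizer exists, and mixing by its square root `S`
moves it to `P = 1`. Since inversion is operator convex, Hahn–Banach turns minimality into positive
weights `ρ`, `σ` for which `P = 1` minimizes `tr(ρ quad a P⁻¹) + tr(σ quad b P)` (`exists_weights`).
Stationarity says that the Gram matrices of the `a i` under `ρ` and of the `b i` under `σ` agree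
(`eq_of_trace_inv_add_trace_minimal`). Hence a contraction `W` carries one weighted family to the
other, and `W`, tested at amplification level `k`, forces the cb norm up to the minimum
(`ofReal_le_cbNorm`). -/

/-! ### Quadratic expressions in a family of matrices -/

/-- The quadratic expression `∑ i j, Q i j • a i * (a j)ᴴ` of a family of matrices. -/
def quad (a : Fin p → Matrix (Fin k) (Fin n) ℂ) (Q : Matrix (Fin p) (Fin p) ℂ) :
    Matrix (Fin k) (Fin k) ℂ :=
  ∑ i, ∑ j, Q i j • (a i * (a j)ᴴ)

lemma quad_one (a : Fin p → Matrix (Fin k) (Fin n) ℂ) : quad a 1 = ∑ i, a i * (a i)ᴴ := by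
  simp [quad, Matrix.one_apply]

lemma quad_add (a : Fin p → Matrix (Fin k) (Fin n) ℂ) (Q Q' : Matrix (Fin p) (Fin p) ℂ) :
    quad a (Q + Q') = quad a Q + quad a Q' := by
  simp [quad, add_smul, Finset.sum_add_distrib]

lemma quad_sub (a : Fin p → Matrix (Fin k) (Fin n) ℂ) (Q Q' : Matrix (Fin p) (Fin p) ℂ) :
    quad a (Q - Q') = quad a Q - quad a Q' := by
  simp [quad, sub_smul, Finset.sum_sub_distrib]

lemma quad_rsmul (a : Fin p → Matrix (Fin k) (Fin n) ℂ) (c : ℝ) (Q : Matrix (Fin p) (Fin p) ℂ) :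
    quad a (c • Q) = c • quad a Q := by
  simp only [quad, Matrix.smul_apply, Finset.smul_sum, smul_assoc]

lemma continuous_quad (a : Fin p → Matrix (Fin k) (Fin n) ℂ) : Continuous (quad a) := by
  unfold quad
  refine continuous_finsetSum _ fun i _ => continuous_finsetSum _ fun j _ => ?_
  exact (continuous_apply_apply i j).smul continuous_const

/-- Mixing the family acts on the coefficient matrix by congruence; this is what later moves the
minimizer to the identity. -/
lemma quad_rightMix (a : Fin p → Matrix (Fin k) (Fin n) ℂ) (T : Matrix (Fin p) (Fin m) ℂ)
    (Q : Matrix (Fin m) (Fin m) ℂ) :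
    ∑ i, ∑ j, Q i j • ((∑ r, T r i • a r) * (∑ r, T r j • a r)ᴴ) = quad a (T * Q * Tᴴ) := by
  have key : ∀ f : Fin m → Fin m → Fin p → Fin p → Matrix (Fin k) (Fin k) ℂ,
      ∑ i, ∑ j, ∑ s, ∑ r, f i j s r = ∑ r, ∑ s, ∑ j, ∑ i, f i j s r := by
    intro f
    calc _ = ∑ x : Fin m × Fin m, ∑ y : Fin p × Fin p, f x.2 x.1 y.2 y.1 := by
          simp only [Fintype.sum_prod_type]
          rw [Finset.sum_comm]
          exact Finset.sum_congr rfl fun _ _ => Finset.sum_congr rfl fun _ _ => Finset.sum_comm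
      _ = ∑ y : Fin p × Fin p, ∑ x : Fin m × Fin m, f x.2 x.1 y.2 y.1 := Finset.sum_comm
      _ = _ := by simp only [Fintype.sum_prod_type]
  simp only [quad, Matrix.mul_apply, Matrix.conjTranspose_sum, Matrix.conjTranspose_smul,
    Matrix.conjTranspose_apply, Finset.sum_smul, Finset.sum_mul, Matrix.sum_mul, Matrix.mul_sum,
    Finset.smul_sum, Matrix.smul_mul, Matrix.mul_smul, smul_smul]
  rw [key]
  refine Finset.sum_congr rfl fun r _ => Finset.sum_congr rfl fun s _ =>
    Finset.sum_congr rfl fun j _ => Finset.sum_congr rfl fun i _ => ?_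
  congr 1
  ring

lemma quad_mul_conjTranspose (a : Fin p → Matrix (Fin k) (Fin n) ℂ)
    (T : Matrix (Fin p) (Fin p) ℂ) :
    quad a (T * Tᴴ) = ∑ j, rightMix a T j * (rightMix a T j)ᴴ := by
  have h := quad_rightMix a T 1
  rw [Matrix.mul_one] at h
  rw [← h, ← quad_one]; rfl

lemma quad_posSemidef (a : Fin p → Matrix (Fin k) (Fin n) ℂ) {Q : Matrix (Fin p) (Fin p) ℂ}
    (hQ : Q.PosSemidef) : (quad a Q).PosSemidef := by
  obtain ⟨B, rfl⟩ := CStarAlgebra.nonneg_iff_eq_star_mul_self.mp hQ.nonneg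
  have := quad_mul_conjTranspose a Bᴴ
  rw [conjTranspose_conjTranspose] at this
  rw [star_eq_conjTranspose, this]
  exact posSemidef_sum _ fun j _ => posSemidef_self_mul_conjTranspose _


/-! ### Coercivity and existence of an optimal `P` -/

/-- With `Q = B * Bᴴ` the expression is a sum of positive terms `G * Gᴴ`; zero trace kills every
mixed matrix `G`, and independence then kills the columns of `B`. -/
lemma eq_zero_of_quad_eq_zero {a : Fin p → Matrix (Fin k) (Fin n) ℂ}
    (ha : LinearIndependent ℂ a) {Q : Matrix (Fin p) (Fin p) ℂ} (hQ : Q.PosSemidef)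
    (h : quad a Q = 0) : Q = 0 := by
  obtain ⟨B, rfl⟩ := CStarAlgebra.nonneg_iff_eq_mul_star_self.mp hQ.nonneg
  rw [star_eq_conjTranspose, quad_mul_conjTranspose] at h
  have h0 : ∀ j, rightMix a B j = 0 := by
    have ht := congrArg trace h
    rw [trace_sum, trace_zero] at ht
    have := (Finset.sum_eq_zero_iff_of_nonneg fun j _ =>
      (posSemidef_self_mul_conjTranspose (rightMix a B j)).trace_nonneg).mp ht
    exact fun j => trace_mul_conjTranspose_self_eq_zero_iff.mp (this j (Finset.mem_univ _))
  have hB : B = 0 := by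
    ext i j
    exact Fintype.linearIndependent_iff.mp ha (fun i => B i j) (h0 j) i
  simp [hB]

lemma isClosed_posSemidef (p : ℕ) :
    IsClosed {Q : Matrix (Fin p) (Fin p) ℂ | Q.PosSemidef} := by
  have : {Q : Matrix (Fin p) (Fin p) ℂ | Q.PosSemidef} = Set.Ici 0 := by
    ext Q; exact nonneg_iff_posSemidef.symm
  rw [this]; exact CStarAlgebra.isClosed_nonneg

/-- By homogeneity it suffices to take the minimum over the compact set of positive semidefinite
matrices of norm one, where independence keeps it nonzero. -/
lemma exists_norm_le_norm_quad {a : Fin p → Matrix (Fin k) (Fin n) ℂ}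
    (ha : LinearIndependent ℂ a) :
    ∃ c : ℝ, 0 < c ∧ ∀ Q : Matrix (Fin p) (Fin p) ℂ, Q.PosSemidef → c * ‖Q‖ ≤ ‖quad a Q‖ := by
  have hcl := isClosed_posSemidef p
  have hK : IsCompact ({Q : Matrix (Fin p) (Fin p) ℂ | Q.PosSemidef} ∩ Metric.sphere 0 1) := by
    have : ProperSpace (Matrix (Fin p) (Fin p) ℂ) := FiniteDimensional.proper ℂ _
    exact (isCompact_sphere 0 1).inter_left hcl
  rcases Set.eq_empty_or_nonempty
    ({Q : Matrix (Fin p) (Fin p) ℂ | Q.PosSemidef} ∩ Metric.sphere 0 1) with he | hne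
  -- Degenerate case, which occurs only for `p = 0`: any constant works.
  · refine ⟨1, one_pos, fun Q hQ => ?_⟩
    by_contra hlt
    have hQ0 : ‖Q‖ ≠ 0 := fun h => hlt (by rw [h]; simp)
    have : ‖Q‖⁻¹ • Q ∈ ({Q : Matrix (Fin p) (Fin p) ℂ | Q.PosSemidef} ∩ Metric.sphere 0 1) :=
      ⟨hQ.smul (by positivity), by simp [norm_smul, hQ0]⟩
    simp [he] at this
  · obtain ⟨Q₀, hQ₀, hmin⟩ := hK.exists_isMinOn hne (continuous_quad a).norm.continuousOn
    refine ⟨‖quad a Q₀‖, norm_pos_iff.mpr fun h => ?_, fun Q hQ => ?_⟩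
    · have := eq_zero_of_quad_eq_zero ha hQ₀.1 h
      simpa [this] using hQ₀.2
    · by_cases hQ0 : ‖Q‖ = 0
      · rw [hQ0]; simp
      have hmem : ‖Q‖⁻¹ • Q ∈
          ({Q : Matrix (Fin p) (Fin p) ℂ | Q.PosSemidef} ∩ Metric.sphere 0 1) :=
        ⟨hQ.smul (by positivity), by simp [norm_smul, hQ0]⟩
      have h1 := hmin hmem
      simp only [Set.mem_ofPred_eq, quad_rsmul, norm_smul, norm_inv, norm_norm] at h1
      rw [inv_mul_eq_div, le_div_iff₀ (by positivity)] at h1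
      exact h1

/-- The maximum of the two norms `‖∑ (P⁻¹) i j • a i * (a j)ᴴ‖` and `‖∑ P i j • b i * (b j)ᴴ‖`
attains its minimum over positive definite `P`. -/
lemma exists_posDef_minimizer {a b : Fin p → Matrix (Fin k) (Fin n) ℂ}
    (ha : LinearIndependent ℂ a) (hb : LinearIndependent ℂ b) :
    ∃ P : Matrix (Fin p) (Fin p) ℂ, P.PosDef ∧ ∀ P' : Matrix (Fin p) (Fin p) ℂ, P'.PosDef →
      max ‖quad a P⁻¹‖ ‖quad b P‖ ≤ max ‖quad a P'⁻¹‖ ‖quad b P'‖ := by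
  obtain ⟨c, hc, hca⟩ := exists_norm_le_norm_quad ha
  obtain ⟨d, hd, hdb⟩ := exists_norm_le_norm_quad hb
  have hcl := isClosed_posSemidef p
  set f : Matrix (Fin p) (Fin p) ℂ × Matrix (Fin p) (Fin p) ℂ → ℝ :=
    fun x => max ‖quad a x.2‖ ‖quad b x.1‖ with hf
  have hfc : Continuous f :=
    ((continuous_quad a).comp continuous_snd).norm.max ((continuous_quad b).comp continuous_fst).norm
  set V := f (1, 1) with hV
  -- Keeping the inverse as a second coordinate makes the constraint closed. Bounding both
  -- coordinates keeps `P` away from infinity and from singular matrices.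
  set K := {x : Matrix (Fin p) (Fin p) ℂ × Matrix (Fin p) (Fin p) ℂ |
    x.1.PosSemidef ∧ x.2.PosSemidef ∧ x.1 * x.2 = 1 ∧ f x ≤ V} with hKdef
  have hKclosed : IsClosed K := by
    refine (hcl.preimage continuous_fst).inter ((hcl.preimage continuous_snd).inter
      (IsClosed.inter ?_ ?_))
    · exact isClosed_eq (continuous_fst.mul continuous_snd) continuous_const
    · exact isClosed_le hfc continuous_const
  have hKb : K ⊆ Metric.closedBall 0 (max (V / d) (V / c)) := by
    rintro x ⟨h1, h2, -, h4⟩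
    rw [mem_closedBall_zero_iff, Prod.norm_def]
    refine max_le_max ?_ ?_
    · rw [le_div_iff₀ hd, mul_comm]
      exact (hdb _ h1).trans ((le_max_right _ _).trans h4)
    · rw [le_div_iff₀ hc, mul_comm]
      exact (hca _ h2).trans ((le_max_left _ _).trans h4)
  have hKc : IsCompact K := by
    have : ProperSpace (Matrix (Fin p) (Fin p) ℂ × Matrix (Fin p) (Fin p) ℂ) :=
      FiniteDimensional.proper ℂ _
    exact (isCompact_closedBall _ _).of_isClosed_subset hKclosed hKb
  obtain ⟨x, hx, hmin⟩ := hKc.exists_isMinOn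
    ⟨(1, 1), PosSemidef.one, PosSemidef.one, one_mul 1, le_rfl⟩ hfc.continuousOn
  have hxi : x.1⁻¹ = x.2 := inv_eq_right_inv hx.2.2.1
  refine ⟨x.1, hx.1.posDef_iff_isUnit.mpr (IsUnit.of_mul_eq_one _ hx.2.2.1), fun P' hP' => ?_⟩
  rw [hxi]
  change f x ≤ f (P', P'⁻¹)
  by_cases h : f (P', P'⁻¹) ≤ V
  · have hmem : (P', P'⁻¹) ∈ K := by
      refine ⟨hP'.posSemidef, hP'.inv.posSemidef, ?_, h⟩
      exact mul_nonsing_inv _ ((isUnit_iff_isUnit_det _).mp hP'.isUnit)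
    exact isMinOn_iff.mp hmin _ hmem
  · exact hx.2.2.2.trans (not_le.mp h).le

/-! ### Operator Cauchy–Schwarz and the upper bound -/

lemma norm_one_kronecker_le {ι κ : Type*} [Fintype ι] [DecidableEq ι] [Fintype κ] [DecidableEq κ]
    (M : Matrix κ κ ℂ) : ‖(1 : Matrix ι ι ℂ) ⊗ₖ M‖ ≤ ‖M‖ := by
  let f : Matrix κ κ ℂ →⋆ₙₐ[ℂ] Matrix (ι × κ) (ι × κ) ℂ :=
    { toFun := fun M => (1 : Matrix ι ι ℂ) ⊗ₖ M
      map_smul' := fun c M => kronecker_smul _ _ _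
      map_zero' := kronecker_zero _
      map_add' := fun M N => kronecker_add _ _ _
      map_mul' := fun M N => by rw [← mul_kronecker_mul, Matrix.one_mul]
      map_star' := fun M => by
        simp only [star_eq_conjTranspose, conjTranspose_kronecker, conjTranspose_one] }
  exact NonUnitalStarAlgHom.norm_apply_le f M

/-- The operator Cauchy–Schwarz inequality for `X ↦ ∑ i, A i * X * B i`. -/
lemma norm_sum_mul_mul_le {ι κ l : Type*} [Fintype ι] [DecidableEq ι] [Fintype κ] [DecidableEq κ]
    [Fintype l] [DecidableEq l] (A : ι → Matrix κ l ℂ) (X : Matrix l l ℂ) (B : ι → Matrix l κ ℂ) :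
    ‖∑ i, A i * X * B i‖ ≤
      √‖∑ i, A i * (A i)ᴴ‖ * ‖X‖ * √‖∑ i, (B i)ᴴ * B i‖ := by
  -- The sum factors as row times `1 ⊗ X` times column.
  let R : Matrix κ (ι × l) ℂ := of fun x y => A y.1 x y.2
  let C : Matrix (ι × l) κ ℂ := of fun y x => B y.1 y.2 x
  have h1 : ∑ i, A i * X * B i = R * ((1 : Matrix ι ι ℂ) ⊗ₖ X) * C := by
    ext x y
    simp [R, C, Matrix.sum_apply, Matrix.mul_apply, Fintype.sum_prod_type, Matrix.one_apply,
      Finset.sum_mul]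
  have hR : R * Rᴴ = ∑ i, A i * (A i)ᴴ := by
    ext x y
    simp [R, Matrix.sum_apply, Matrix.mul_apply, Fintype.sum_prod_type]
  have hC : Cᴴ * C = ∑ i, (B i)ᴴ * B i := by
    ext x y
    simp [C, Matrix.sum_apply, Matrix.mul_apply, Fintype.sum_prod_type]
  have hRn : √‖∑ i, A i * (A i)ᴴ‖ = ‖R‖ := by
    have := l2_opNorm_conjTranspose_mul_self Rᴴ
    rw [conjTranspose_conjTranspose, l2_opNorm_conjTranspose] at this
    rw [← hR, this, Real.sqrt_mul_self (norm_nonneg _)]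
  have hCn : √‖∑ i, (B i)ᴴ * B i‖ = ‖C‖ := by
    rw [← hC, l2_opNorm_conjTranspose_mul_self, Real.sqrt_mul_self (norm_nonneg _)]
  rw [h1, hRn, hCn]
  calc _ ≤ ‖R * ((1 : Matrix ι ι ℂ) ⊗ₖ X)‖ * ‖C‖ := l2_opNorm_mul _ _
    _ ≤ (‖R‖ * ‖(1 : Matrix ι ι ℂ) ⊗ₖ X‖) * ‖C‖ := by gcongr; exact l2_opNorm_mul _ _
    _ ≤ _ := by gcongr; exact norm_one_kronecker_le X

lemma amplification_eq_sum
    {φ : Matrix (Fin n) (Fin n) ℂ →ₗ[ℂ] Matrix (Fin k) (Fin k) ℂ}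
    {A : Fin p → Matrix (Fin k) (Fin n) ℂ} {B : Fin p → Matrix (Fin n) (Fin k) ℂ}
    (h : IsChoiKraus φ A B) (X : Matrix (Fin m × Fin n) (Fin m × Fin n) ℂ) :
    amplification φ m X =
      ∑ i, ((1 : Matrix (Fin m) (Fin m) ℂ) ⊗ₖ A i) * X * ((1 : Matrix (Fin m) (Fin m) ℂ) ⊗ₖ B i) := by
  ext ⟨r, x⟩ ⟨s, y⟩
  rw [amplification, comp_apply, map_apply, h]
  simp [Matrix.sum_apply, Matrix.mul_apply, Fintype.sum_prod_type, Matrix.one_apply]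

lemma cost_eq_ofReal (A : Fin p → Matrix (Fin k) (Fin n) ℂ)
    (B : Fin p → Matrix (Fin n) (Fin k) ℂ) :
    cost A B = ENNReal.ofReal (√‖∑ i, A i * (A i)ᴴ‖ * √‖∑ i, (B i)ᴴ * B i‖) := by
  rw [cost, ENNReal.ofReal_mul (Real.sqrt_nonneg _), Real.sqrt_eq_rpow, Real.sqrt_eq_rpow,
    ← ENNReal.ofReal_rpow_of_nonneg (norm_nonneg _) (by norm_num),
    ← ENNReal.ofReal_rpow_of_nonneg (norm_nonneg _) (by norm_num), ofReal_norm, ofReal_norm]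

lemma cbNorm_le_cost {φ : Matrix (Fin n) (Fin n) ℂ →ₗ[ℂ] Matrix (Fin k) (Fin k) ℂ}
    {A : Fin p → Matrix (Fin k) (Fin n) ℂ} {B : Fin p → Matrix (Fin n) (Fin k) ℂ}
    (h : IsChoiKraus φ A B) : cbNorm φ ≤ cost A B := by
  refine iSup₂_le fun m _ => iSup₂_le fun X hX => ?_
  rw [cost_eq_ofReal, ← ofReal_norm]
  refine ENNReal.ofReal_le_ofReal ?_
  rw [amplification_eq_sum h]
  refine (norm_sum_mul_mul_le _ _ _).trans ?_
  have hA : ∑ i, ((1 : Matrix (Fin m) (Fin m) ℂ) ⊗ₖ A i) * ((1 : Matrix (Fin m) (Fin m) ℂ) ⊗ₖ A i)ᴴ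
      = (1 : Matrix (Fin m) (Fin m) ℂ) ⊗ₖ (∑ i, A i * (A i)ᴴ) := by
    simp only [conjTranspose_kronecker, conjTranspose_one, ← mul_kronecker_mul, Matrix.one_mul]
    ext ⟨r, x⟩ ⟨s, y⟩
    simp [Matrix.sum_apply, Finset.mul_sum]
  have hB : ∑ i, ((1 : Matrix (Fin m) (Fin m) ℂ) ⊗ₖ B i)ᴴ * ((1 : Matrix (Fin m) (Fin m) ℂ) ⊗ₖ B i)
      = (1 : Matrix (Fin m) (Fin m) ℂ) ⊗ₖ (∑ i, (B i)ᴴ * B i) := by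
    simp only [conjTranspose_kronecker, conjTranspose_one, ← mul_kronecker_mul, Matrix.one_mul]
    ext ⟨r, x⟩ ⟨s, y⟩
    simp [Matrix.sum_apply, Finset.mul_sum]
  rw [hA, hB]
  calc _ ≤ √‖∑ i, A i * (A i)ᴴ‖ * 1 * √‖∑ i, (B i)ᴴ * B i‖ := by
        gcongr <;> exact norm_one_kronecker_le _
    _ = _ := by rw [mul_one]

/-! ### Tensor representations, minimal length and reduction -/

lemma isChoiKraus_of_tensor_eq {r : ℕ}
    {φ : Matrix (Fin n) (Fin n) ℂ →ₗ[ℂ] Matrix (Fin k) (Fin k) ℂ}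
    {E : Fin p → Matrix (Fin k) (Fin n) ℂ} {F : Fin p → Matrix (Fin n) (Fin k) ℂ}
    {A : Fin r → Matrix (Fin k) (Fin n) ℂ} {B : Fin r → Matrix (Fin n) (Fin k) ℂ}
    (h : IsChoiKraus φ E F) (hu : ∑ i, E i ⊗ₜ[ℂ] F i = ∑ i, A i ⊗ₜ[ℂ] B i) :
    IsChoiKraus φ A B := by
  intro X
  let f : Matrix (Fin k) (Fin n) ℂ →ₗ[ℂ] Matrix (Fin n) (Fin k) ℂ →ₗ[ℂ]
      Matrix (Fin k) (Fin k) ℂ :=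
    LinearMap.mk₂ ℂ (fun A B => A * X * B)
      (fun A A' B => by simp [Matrix.add_mul]) (fun c A B => by simp)
      (fun A B B' => by simp [Matrix.mul_add]) (fun c A B => by simp)
  have := congrArg (TensorProduct.lift f) hu
  simp only [map_sum, TensorProduct.lift.tmul] at this
  exact (h X).trans this

/-- Functionals dual to the `F j`, applied to the second tensor factor, recover each `E j` as a
combination of the `A i`; a dimension count finishes. -/
lemma card_le_of_tensor_eq {r : ℕ}
    {E : Fin p → Matrix (Fin k) (Fin n) ℂ} {F : Fin p → Matrix (Fin n) (Fin k) ℂ}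
    {A : Fin r → Matrix (Fin k) (Fin n) ℂ} {B : Fin r → Matrix (Fin n) (Fin k) ℂ}
    (hE : LinearIndependent ℂ E) (hF : LinearIndependent ℂ F)
    (hu : ∑ i, E i ⊗ₜ[ℂ] F i = ∑ i, A i ⊗ₜ[ℂ] B i) : p ≤ r := by
  obtain ⟨g, hg⟩ := LinearMap.exists_leftInverse_of_injective
    (Fintype.linearCombination ℂ F) (LinearMap.ker_eq_bot.mpr
      hF.fintypeLinearCombination_injective)
  have hgF : ∀ i j, g (F i) j = if i = j then 1 else 0 := by
    intro i j
    have := congrFun (LinearMap.congr_fun hg (Pi.single i 1)) j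
    simpa [Pi.single_apply, eq_comm] using this
  have hmem : ∀ j, E j ∈ Submodule.span ℂ (Set.range A) := by
    intro j
    have := congrArg (TensorProduct.lift (LinearMap.mk₂ ℂ
      (fun (A : Matrix (Fin k) (Fin n) ℂ) (B : Matrix (Fin n) (Fin k) ℂ) => g B j • A)
      (fun A A' B => by simp) (fun c A B => by rw [smul_comm])
      (fun A B B' => by simp [add_smul]) (fun c A B => by simp [smul_smul]))) hu
    simp only [map_sum, TensorProduct.lift.tmul, LinearMap.mk₂_apply, hgF] at this
    simp only [ite_smul, one_smul, zero_smul, Finset.sum_ite_eq', Finset.mem_univ, if_true] at this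
    rw [this]
    exact Submodule.sum_mem _ fun i _ =>
      Submodule.smul_mem _ _ (Submodule.subset_span (Set.mem_range_self i))
  calc p = (Set.range E).finrank ℂ := by rw [Set.finrank, finrank_span_eq_card hE, Fintype.card_fin]
    _ ≤ (Set.range A).finrank ℂ := Submodule.finrank_mono (Submodule.span_le.mpr
        (by rintro _ ⟨j, rfl⟩; exact hmem j))
    _ ≤ r := (finrank_range_le_card A).trans_eq (Fintype.card_fin r)

lemma IsReduction.isChoiKraus_linearIndependent
    {φ : Matrix (Fin n) (Fin n) ℂ →ₗ[ℂ] Matrix (Fin k) (Fin k) ℂ}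
    {A : Fin m → Matrix (Fin k) (Fin n) ℂ} {B : Fin m → Matrix (Fin n) (Fin k) ℂ}
    {E : Fin p → Matrix (Fin k) (Fin n) ℂ} {F : Fin p → Matrix (Fin n) (Fin k) ℂ}
    (h : IsChoiKraus φ A B) (hr : IsReduction A B E F) :
    IsChoiKraus φ E F ∧ LinearIndependent ℂ E ∧ LinearIndependent ℂ F := by
  obtain ⟨l, C, D, d, e, hC, -, hB, hD, hE, hED, hDe, hF⟩ := hr
  refine ⟨fun X => ?_, hE, ?_⟩
  · have h1 : ∑ i, A i * X * B i = ∑ j, D j * X * C j := by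
      simp only [hB, hD, Matrix.mul_sum, Matrix.sum_mul, Matrix.mul_smul, Matrix.smul_mul]
      exact Finset.sum_comm
    have h2 : ∑ j, D j * X * C j = ∑ i, E i * X * F i := by
      simp only [hDe, hF, Matrix.mul_sum, Matrix.sum_mul, Matrix.mul_smul, Matrix.smul_mul]
      exact Finset.sum_comm
    rw [h X, h1, h2]
  -- Expressing `E` back in terms of `D` gives a left inverse of `e`, so a relation among the `F i`
  -- passes to `C` without loss.
  · have hmem : ∀ i, ∃ c : Fin l → ℂ, ∑ j, c j • D j = E i := by
      intro i
      have : E i ∈ Submodule.span ℂ (Set.range D) := hED ▸ Submodule.subset_span ⟨i, rfl⟩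
      exact (Submodule.mem_span_range_iff_exists_fun ℂ).mp this
    choose f hf using hmem
    have hfe : ∀ i i', ∑ j, f i j * e j i' = if i = i' then 1 else 0 := by
      intro i
      have h0 : ∑ i', (∑ j, f i j * e j i' - if i = i' then 1 else 0) • E i' = 0 := by
        simp only [sub_smul, Finset.sum_sub_distrib, ite_smul, one_smul, zero_smul,
          Finset.sum_ite_eq, Finset.mem_univ, if_true, Finset.sum_smul, mul_smul]
        rw [Finset.sum_comm]
        simp only [← Finset.smul_sum, ← hDe, hf, sub_self]
      exact fun i' => sub_eq_zero.mp (Fintype.linearIndependent_iff.mp hE _ h0 i')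
    rw [Fintype.linearIndependent_iff]
    intro c hc
    have h0 : ∑ j, (∑ i, c i * e j i) • C j = 0 := by
      rw [← hc]
      simp only [hF, Finset.sum_smul, Finset.smul_sum, mul_smul]
      exact Finset.sum_comm
    have h1 := Fintype.linearIndependent_iff.mp hC _ h0
    intro i
    calc c i = ∑ i', c i' * (if i = i' then 1 else 0) := by simp
      _ = ∑ i', c i' * ∑ j, f i j * e j i' := by simp only [hfe]
      _ = ∑ j, f i j * ∑ i', c i' * e j i' := by
          simp only [Finset.mul_sum]
          rw [Finset.sum_comm]
          exact Finset.sum_congr rfl fun _ _ => Finset.sum_congr rfl fun _ _ => by ring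
      _ = 0 := by simp [h1]

/-! ### Operator convexity, trace duality and separation -/

/-- Inversion of positive definite matrices is operator convex. -/
lemma inv_convex {P Q : Matrix (Fin p) (Fin p) ℂ} (hP : P.PosDef) (hQ : Q.PosDef) {s t : ℝ}
    (hs : 0 < s) (ht : 0 < t) (hst : s + t = 1) :
    (s • P⁻¹ + t • Q⁻¹ - (s • P + t • Q)⁻¹).PosSemidef := by
  -- The Schur complement of this block matrix is zero. Averaging two such matrices and taking the
  -- Schur complement again gives convexity.
  have key : ∀ {A : Matrix (Fin p) (Fin p) ℂ}, A.PosDef → (fromBlocks A 1 1ᴴ A⁻¹).PosSemidef := by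
    intro A hA
    have := hA.isUnit.invertible
    rw [PosDef.fromBlocks₁₁ _ _ hA]
    simpa using PosSemidef.zero
  have hsum : (s • P + t • Q).PosDef := (hP.smul hs).add (hQ.smul ht)
  have := hsum.isUnit.invertible
  have h := ((key hP).smul hs.le).add ((key hQ).smul ht.le)
  have h1 : s • fromBlocks P 1 1ᴴ P⁻¹ + t • fromBlocks Q 1 1ᴴ Q⁻¹ =
      fromBlocks (s • P + t • Q) 1 1ᴴ (s • P⁻¹ + t • Q⁻¹) := by
    rw [fromBlocks_smul, fromBlocks_smul, fromBlocks_add, conjTranspose_one, ← add_smul, hst,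
      one_smul]
  rw [h1, PosDef.fromBlocks₁₁ _ _ hsum] at h
  simpa using h

lemma trace_mul_nonneg {κ : Type*} [Fintype κ] [DecidableEq κ] {ρ M : Matrix κ κ ℂ}
    (hρ : ρ.PosSemidef) (hM : M.PosSemidef) : 0 ≤ (ρ * M).trace := by
  obtain ⟨C, rfl⟩ := CStarAlgebra.nonneg_iff_eq_star_mul_self.mp hρ.nonneg
  rw [star_eq_conjTranspose, Matrix.mul_assoc, trace_mul_comm]
  exact (hM.mul_mul_conjTranspose_same C).trace_nonneg

lemma trace_mul_re_le {κ : Type*} [Fintype κ] [DecidableEq κ] {ρ M : Matrix κ κ ℂ}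
    (hρ : ρ.PosSemidef) (hM : M.IsHermitian) :
    (ρ * M).trace.re ≤ ‖M‖ * ρ.trace.re := by
  have h1 : M ≤ algebraMap ℝ _ ‖M‖ := IsSelfAdjoint.le_algebraMap_norm_self hM
  have h2 := trace_mul_nonneg hρ (le_iff.mp h1)
  rw [Matrix.mul_sub, trace_sub, Algebra.algebraMap_eq_smul_one, mul_smul_comm, Matrix.mul_one,
    trace_smul, sub_nonneg] at h2
  have := (Complex.le_def.mp h2).1
  simpa using this

/-- A real-linear functional which is nonnegative on positive semidefinite matrices is given by
a density. -/
lemma exists_posSemidef_trace_eq {κ : Type*} [Fintype κ] [DecidableEq κ]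
    (f : Matrix κ κ ℂ →ₗ[ℂ] ℂ) (hf : ∀ M : Matrix κ κ ℂ, M.PosSemidef → 0 ≤ (f M).re) :
    ∃ ρ : Matrix κ κ ℂ, ρ.PosSemidef ∧
      ∀ M : Matrix κ κ ℂ, M.IsHermitian → (ρ * M).trace.re = (f M).re := by
  let r : Matrix κ κ ℂ := of fun y x => f (single x y 1)
  have hr : ∀ M, (r * M).trace = f M := by
    intro M
    conv_rhs => rw [matrix_eq_sum_single M]
    simp only [map_sum, trace, diag_apply, mul_apply, r, of_apply]
    rw [Finset.sum_comm]
    refine Finset.sum_congr rfl fun i _ => Finset.sum_congr rfl fun j _ => ?_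
    rw [show single i j (M i j) = M i j • single i j (1 : ℂ) by simp, map_smul, smul_eq_mul,
      mul_comm]
  have hre : ∀ M : Matrix κ κ ℂ, M.IsHermitian →
      ((((1 / 2 : ℝ) • (r + rᴴ)) * M).trace).re = (f M).re := by
    intro M hM
    have h1 : (rᴴ * M).trace = star (r * M).trace := by
      rw [← trace_conjTranspose, conjTranspose_mul, hM.eq, trace_mul_comm]
    rw [Matrix.smul_mul, trace_smul, Matrix.add_mul, trace_add, h1, hr]
    simp only [Complex.smul_re, Complex.add_re, Complex.star_def, Complex.conj_re, smul_eq_mul]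
    ring
  have hH : ((1 / 2 : ℝ) • (r + rᴴ)).IsHermitian := by
    simp [IsHermitian, conjTranspose_smul, add_comm]
  -- Taking the Hermitian part of the representing matrix leaves the real part of the pairing with
  -- Hermitian matrices unchanged.
  refine ⟨(1 / 2 : ℝ) • (r + rᴴ), PosSemidef.of_dotProduct_mulVec_nonneg hH fun x => ?_, hre⟩
  have h2 := posSemidef_vecMulVec_self_star x
  have h3 := hf _ h2
  rw [← hre _ h2.isHermitian, mul_vecMulVec, trace_vecMulVec, dotProduct_comm] at h3
  rw [Complex.le_def]
  exact ⟨h3, (hH.im_star_dotProduct_mulVec_self x).symm⟩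

/-- Separation of a ball from the set of pairs dominating `(quad a P⁻¹, quad b P)`. -/
lemma exists_weights {a b : Fin p → Matrix (Fin k) (Fin n) ℂ} {V : ℝ} (hV : 0 < V)
    (hmin : ∀ P : Matrix (Fin p) (Fin p) ℂ, P.PosDef → V ≤ max ‖quad a P⁻¹‖ ‖quad b P‖) :
    ∃ (ρ σ : Matrix (Fin k) (Fin k) ℂ) (u : ℝ), ρ.PosSemidef ∧ σ.PosSemidef ∧ 0 < u ∧
      V * (ρ.trace.re + σ.trace.re) ≤ u ∧
      ∀ P : Matrix (Fin p) (Fin p) ℂ, P.PosDef →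
        u ≤ (ρ * quad a P⁻¹).trace.re + (σ * quad b P).trace.re := by
  -- Domination in place of equality makes the set convex and upward closed; the latter forces the
  -- separating functional to be positive.
  let W : Set (Matrix (Fin k) (Fin k) ℂ × Matrix (Fin k) (Fin k) ℂ) :=
    {x | ∃ P : Matrix (Fin p) (Fin p) ℂ, P.PosDef ∧ quad a P⁻¹ ≤ x.1 ∧ quad b P ≤ x.2}
  have hW : Convex ℝ W := by
    rw [convex_iff_forall_pos]
    rintro x ⟨P, hP, hx1, hx2⟩ y ⟨Q, hQ, hy1, hy2⟩ s t hs ht hst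
    refine ⟨s • P + t • Q, (hP.smul hs).add (hQ.smul ht), ?_, ?_⟩
    · have h1 := quad_posSemidef a (inv_convex hP hQ hs ht hst)
      rw [quad_sub, quad_add, quad_rsmul, quad_rsmul] at h1
      refine (le_iff.mpr h1).trans ?_
      have h2 := ((le_iff.mp hx1).smul hs.le).add ((le_iff.mp hy1).smul ht.le)
      rw [le_iff]
      convert h2 using 1
      simp only [Prod.fst_add, Prod.smul_fst, smul_sub]
      abel
    · have h2 := ((le_iff.mp hx2).smul hs.le).add ((le_iff.mp hy2).smul ht.le)
      rw [le_iff, quad_add, quad_rsmul, quad_rsmul]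
      convert h2 using 1
      simp only [Prod.snd_add, Prod.smul_snd, smul_sub]
      abel
  have hdisj : Disjoint (Metric.ball 0 V) W := by
    rw [Set.disjoint_left]
    rintro x hx ⟨P, hP, h1, h2⟩
    rw [mem_ball_zero_iff, Prod.norm_def, max_lt_iff] at hx
    have h3 := CStarAlgebra.norm_le_norm_of_nonneg_of_le
      (quad_posSemidef a hP.inv.posSemidef).nonneg h1
    have h4 := CStarAlgebra.norm_le_norm_of_nonneg_of_le
      (quad_posSemidef b hP.posSemidef).nonneg h2
    exact absurd (hmin P hP) (not_le.mpr (max_lt (h3.trans_lt hx.1) (h4.trans_lt hx.2)))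
  obtain ⟨f, u, hfb, hfW⟩ := RCLike.geometric_hahn_banach_open (𝕜 := ℂ) (convex_ball _ _)
    Metric.isOpen_ball hW hdisj
  have hu : 0 < u := by simpa using hfb 0 (by simpa using hV)
  have hmem : ∀ P : Matrix (Fin p) (Fin p) ℂ, P.PosDef → ∀ M N : Matrix (Fin k) (Fin k) ℂ,
      M.PosSemidef → N.PosSemidef → (quad a P⁻¹ + M, quad b P + N) ∈ W := fun P hP M N hM hN =>
    ⟨P, hP, le_add_of_nonneg_right hM.nonneg, le_add_of_nonneg_right hN.nonneg⟩
  have hcone : ∀ M N : Matrix (Fin k) (Fin k) ℂ, M.PosSemidef → N.PosSemidef →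
      0 ≤ (f (M, N)).re := by
    intro M N hM hN
    by_contra hneg
    rw [not_le] at hneg
    set z := (f (quad a (1 : Matrix (Fin p) (Fin p) ℂ)⁻¹, quad b 1)).re
    have hz : ∀ t : ℝ, 0 ≤ t → u ≤ z + t * (f (M, N)).re := by
      intro t ht
      have := hfW _ (hmem 1 PosDef.one (t • M) (t • N) (hM.smul ht) (hN.smul ht))
      have he : ((quad a (1 : Matrix (Fin p) (Fin p) ℂ)⁻¹ + t • M, quad b 1 + t • N) :
          Matrix (Fin k) (Fin k) ℂ × Matrix (Fin k) (Fin k) ℂ) =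
          (quad a (1 : Matrix (Fin p) (Fin p) ℂ)⁻¹, quad b 1) + (t : ℂ) • (M, N) := by
        ext <;> simp
      rw [he, map_add, map_smul] at this
      simpa [z] using this
    have h0 := hz 0 le_rfl
    -- At this `t` the lower-bounded quantity vanishes, contradicting `0 < u`.
    have h1 := hz (z / -(f (M, N)).re) (div_nonneg (by linarith) (by linarith))
    have h2 : z / -(f (M, N)).re * (f (M, N)).re = -z := by
      have := hneg.ne; field_simp
    linarith
  obtain ⟨ρ, hρ, hρf⟩ := exists_posSemidef_trace_eq
    (f.toLinearMap ∘ₗ LinearMap.inl ℂ _ _) fun M hM => hcone M 0 hM PosSemidef.zero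
  obtain ⟨σ, hσ, hσf⟩ := exists_posSemidef_trace_eq
    (f.toLinearMap ∘ₗ LinearMap.inr ℂ _ _) fun M hM => hcone 0 M PosSemidef.zero hM
  have hsum : ∀ M N : Matrix (Fin k) (Fin k) ℂ, M.IsHermitian → N.IsHermitian →
      (ρ * M).trace.re + (σ * N).trace.re = (f (M, N)).re := by
    intro M N hM hN
    rw [hρf M hM, hσf N hN]
    simp only [LinearMap.comp_apply, LinearMap.inl_apply, LinearMap.inr_apply,
      ContinuousLinearMap.coe_coe]
    rw [← Complex.add_re, ← map_add, Prod.mk_add_mk, add_zero, zero_add]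
  refine ⟨ρ, σ, u, hρ, hσ, hu, ?_, fun P hP => ?_⟩
  · have h1 := hsum 1 1 isHermitian_one isHermitian_one
    rw [Matrix.mul_one, Matrix.mul_one] at h1
    rw [h1]
    by_contra hlt
    rw [not_le] at hlt
    set w := (f ((1 : Matrix (Fin k) (Fin k) ℂ), (1 : Matrix (Fin k) (Fin k) ℂ))).re
    have hw : 0 < w := by
      by_contra hw
      nlinarith
    have hs : u / w < V := by rwa [div_lt_iff₀ hw]
    have hn1 : ‖(1 : Matrix (Fin k) (Fin k) ℂ)‖ ≤ 1 := by
      rw [← diagonal_one, l2_opNorm_diagonal]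
      exact (pi_norm_le_iff_of_nonneg zero_le_one).mpr fun _ => by simp
    -- This multiple of the identity pair lies in the ball, yet the functional already equals `u`
    -- there.
    have hb := hfb (((u / w : ℝ) : ℂ) • (1, 1)) (by
      rw [mem_ball_zero_iff, norm_smul, Complex.norm_real, Real.norm_of_nonneg (by positivity)]
      refine (mul_le_of_le_one_right (by positivity) ?_).trans_lt hs
      rw [Prod.norm_def]; exact max_le hn1 hn1)
    rw [map_smul] at hb
    have : u / w * w < u := by simpa using hb
    rw [div_mul_cancel₀ _ hw.ne'] at this
    exact lt_irrefl _ this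
  · rw [hsum _ _ (quad_posSemidef a hP.inv.posSemidef).isHermitian
      (quad_posSemidef b hP.posSemidef).isHermitian]
    simpa using hfW _ (hmem P hP 0 0 PosSemidef.zero PosSemidef.zero)

/-! ### Stationarity and the contraction -/

/-- Along the path `exp (t • D)` with `D = R - S`, the derivative at `0` is `-tr(D * D)`; minimality
makes it vanish, so `D = 0`. -/
lemma eq_of_trace_inv_add_trace_minimal {R S : Matrix (Fin p) (Fin p) ℂ} (hR : R.IsHermitian)
    (hS : S.IsHermitian)
    (h : ∀ P : Matrix (Fin p) (Fin p) ℂ, P.PosDef →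
      R.trace.re + S.trace.re ≤ (R * P⁻¹).trace.re + (S * P).trace.re) : R = S := by
  set D := R - S with hD
  have hDH : D.IsHermitian := hR.sub hS
  let tr : Matrix (Fin p) (Fin p) ℂ →L[ℝ] ℝ := LinearMap.toContinuousLinearMap
    (Complex.reLm ∘ₗ (traceLinearMap (Fin p) ℝ ℂ))
  have htr : ∀ M, tr M = M.trace.re := fun M => rfl
  let g : ℝ → ℝ := fun t =>
    tr (R * NormedSpace.exp (t • (-D))) + tr (S * NormedSpace.exp (t • D))
  have hg : HasDerivAt g (tr (R * (-D)) + tr (S * D)) 0 := by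
    have h1 := hasDerivAt_exp_smul_const (𝕂 := ℝ) (-D) 0
    have h2 := hasDerivAt_exp_smul_const (𝕂 := ℝ) D 0
    simp only [zero_smul, NormedSpace.exp_zero, one_mul] at h1 h2
    exact (tr.hasFDerivAt.comp_hasDerivAt 0 (h1.const_mul R)).add
      (tr.hasFDerivAt.comp_hasDerivAt 0 (h2.const_mul S))
  have hmin : IsLocalMin g 0 := by
    refine Filter.Eventually.of_forall fun t => ?_
    have hH : (t • D).IsHermitian := by
      rw [IsHermitian, conjTranspose_smul, hDH.eq]; simp
    have hpos : (NormedSpace.exp (t • D)).PosDef := by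
      have hu : IsUnit (NormedSpace.exp (t • D)) := Matrix.isUnit_exp _
      refine PosSemidef.posDef_iff_isUnit ?_ |>.mpr hu
      have h2 : NormedSpace.exp (t • D) =
          NormedSpace.exp ((1 / 2 : ℝ) • t • D) * (NormedSpace.exp ((1 / 2 : ℝ) • t • D))ᴴ := by
        have h3 : ((1 / 2 : ℝ) • t • D)ᴴ = (1 / 2 : ℝ) • t • D := by
          rw [conjTranspose_smul, hH.eq]; simp
        rw [← Matrix.exp_conjTranspose, h3, ← Matrix.exp_add_of_commute _ _ (Commute.refl _),
          ← add_smul]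
        norm_num
      rw [h2]
      exact posSemidef_self_mul_conjTranspose _
    have := h _ hpos
    rw [← Matrix.exp_neg, ← smul_neg] at this
    simpa [g, htr] using this
  have h0 := hmin.hasDerivAt_eq_zero hg
  have h1 : (Dᴴ * D).trace.re = 0 := by
    rw [hDH.eq]
    conv_lhs => rw [hD, Matrix.sub_mul, ← hD]
    simp only [htr, Matrix.mul_neg, trace_neg, Complex.neg_re] at h0
    rw [trace_sub, Complex.sub_re]
    linarith
  have h2 : (Dᴴ * D).trace = 0 := by
    have h3 := (posSemidef_conjTranspose_mul_self D).trace_nonneg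
    exact Complex.ext h1 (Complex.le_def.mp h3).2.symm
  exact sub_eq_zero.mp (trace_conjTranspose_mul_self_eq_zero_iff.mp h2)

/-- Two families with equal Gram matrices are related by a contraction. -/
lemma exists_contraction_of_gram_eq {ι : Type*} [Fintype ι] [DecidableEq ι]
    (x y : Fin p → EuclideanSpace ℂ ι) (h : ∀ i j, inner ℂ (x i) (x j) = inner ℂ (y i) (y j)) :
    ∃ W : Matrix ι ι ℂ, ‖W‖ ≤ 1 ∧ ∀ i, W *ᵥ (y i).ofLp = (x i).ofLp := by
  let X := Fintype.linearCombination ℂ x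
  let Y := Fintype.linearCombination ℂ y
  have hn : ∀ c, ‖X c‖ = ‖Y c‖ := by
    intro c
    have : inner ℂ (X c) (X c) = inner ℂ (Y c) (Y c) := by
      simp only [X, Y, Fintype.linearCombination_apply, sum_inner, inner_sum, inner_smul_left,
        inner_smul_right, h]
    rw [@norm_eq_sqrt_re_inner ℂ, @norm_eq_sqrt_re_inner ℂ _ _ _ _ (Y c), this]
  obtain ⟨g, hg⟩ := Y.rangeRestrict.exists_rightInverse_of_surjective Y.range_rangeRestrict
  have hg' : ∀ v : Y.range, Y (g v) = v := fun v =>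
    congrArg Subtype.val (LinearMap.congr_fun hg v)
  -- Equal Gram matrices give `‖X c‖ = ‖Y c‖`, so `Y c ↦ X c` is well defined and isometric whatever
  -- section `g` is chosen.
  let L : Y.range →ₗᵢ[ℂ] EuclideanSpace ℂ ι :=
    { toLinearMap := X ∘ₗ g
      norm_map' := fun v => by
        rw [LinearMap.comp_apply, hn, hg']; rfl }
  have hL : ∀ c, L ⟨Y c, LinearMap.mem_range_self Y c⟩ = X c := by
    intro c
    have h1 : X (g ⟨Y c, LinearMap.mem_range_self Y c⟩ - c) = 0 := by
      rw [← norm_eq_zero, hn, map_sub, hg', sub_self, norm_zero]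
    rw [map_sub, sub_eq_zero] at h1
    exact h1
  let T := L.extend
  refine ⟨toEuclideanCLM (𝕜 := ℂ) |>.symm T.toContinuousLinearMap, ?_, fun i => ?_⟩
  · rw [cstar_norm_def, StarAlgEquiv.apply_symm_apply]
    exact T.norm_toContinuousLinearMap_le
  · rw [← ofLp_toEuclideanCLM, StarAlgEquiv.apply_symm_apply]
    have hY : Y (Pi.single i 1) = y i := by simp [Y]
    have hX : X (Pi.single i 1) = x i := by simp [X]
    have h1 := L.extend_apply ⟨Y (Pi.single i 1), LinearMap.mem_range_self Y _⟩
    rw [hL] at h1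
    simp only [hX, hY] at h1
    rw [← h1]; rfl

/-! ### Vectorization and the lower bound -/

/-- `vec` of the entrywise conjugate of a matrix, as a Euclidean vector. -/
def conjVec {κ l : Type*} (C : Matrix κ l ℂ) : EuclideanSpace ℂ (κ × l) :=
  WithLp.toLp 2 fun z => star (C z.1 z.2)

lemma inner_conjVec {κ l : Type*} [Fintype κ] [Fintype l] (C D : Matrix κ l ℂ) :
    inner ℂ (conjVec C) (conjVec D) = (C * Dᴴ).trace := by
  simp [conjVec, EuclideanSpace.inner_eq_star_dotProduct, dotProduct, trace, mul_apply,
    Fintype.sum_prod_type, mul_comm]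

lemma norm_conjVec {κ : Type*} [Fintype κ] (C : Matrix κ κ ℂ) :
    ‖conjVec C‖ = √(Cᴴ * C).trace.re := by
  rw [@norm_eq_sqrt_re_inner ℂ, inner_conjVec, trace_mul_comm]; rfl

/-- The conjugation in `conjVec` makes adjoints appear here instead of transposes, matching the
coefficients `(b i)ᴴ` of the map. -/
lemma kronecker_mulVec_conjVec {κ l ι : Type*} [Fintype κ] [DecidableEq κ] [Fintype l]
    (C : Matrix κ l ℂ) (A : Matrix l ι ℂ) :
    ((1 : Matrix κ κ ℂ) ⊗ₖ Aᴴ) *ᵥ (conjVec C).ofLp = (conjVec (C * A)).ofLp := by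
  ext ⟨r, u⟩
  simp [conjVec, mulVec, dotProduct, Fintype.sum_prod_type, Matrix.one_apply, mul_apply, mul_comm]

lemma trace_mul_quad (ρ : Matrix (Fin k) (Fin k) ℂ) (a : Fin p → Matrix (Fin k) (Fin n) ℂ)
    (Q : Matrix (Fin p) (Fin p) ℂ) :
    (ρ * quad a Q).trace = ((of fun i j => (ρ * (a j * (a i)ᴴ)).trace) * Q).trace := by
  simp only [quad, Matrix.mul_sum, trace_sum, Matrix.mul_smul, trace_smul, smul_eq_mul]
  rw [Finset.sum_comm]
  simp only [trace, diag_apply, mul_apply, of_apply, mul_comm]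

lemma isHermitian_gram {ρ : Matrix (Fin k) (Fin k) ℂ} (hρ : ρ.IsHermitian)
    (a : Fin p → Matrix (Fin k) (Fin n) ℂ) :
    (of fun i j => (ρ * (a j * (a i)ᴴ)).trace : Matrix (Fin p) (Fin p) ℂ).IsHermitian := by
  ext i j
  rw [conjTranspose_apply, of_apply, of_apply, ← trace_conjTranspose, conjTranspose_mul,
    conjTranspose_mul, conjTranspose_conjTranspose, hρ.eq, trace_mul_comm]

/-- If `P = 1` minimizes `max ‖quad a P⁻¹‖ ‖quad b P‖`, then the minimum is at most the completely
bounded norm of `X ↦ ∑ i, a i * X * (b i)ᴴ`. -/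
lemma ofReal_le_cbNorm {φ : Matrix (Fin n) (Fin n) ℂ →ₗ[ℂ] Matrix (Fin k) (Fin k) ℂ}
    {a b : Fin p → Matrix (Fin k) (Fin n) ℂ} (hφ : IsChoiKraus φ a fun i => (b i)ᴴ) {V : ℝ}
    (ha : ‖quad a 1‖ ≤ V) (hb : ‖quad b 1‖ ≤ V)
    (hmin : ∀ P : Matrix (Fin p) (Fin p) ℂ, P.PosDef → V ≤ max ‖quad a P⁻¹‖ ‖quad b P‖) :
    ENNReal.ofReal V ≤ cbNorm φ := by
  rcases le_or_gt V 0 with hV | hV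
  · rw [ENNReal.ofReal_of_nonpos hV]; exact zero_le
  have hk : 1 ≤ k := by
    by_contra hk
    obtain rfl : k = 0 := by omega
    have := hmin 1 PosDef.one
    rw [Subsingleton.elim (quad a (1 : Matrix (Fin p) (Fin p) ℂ)⁻¹) 0,
      Subsingleton.elim (quad b 1) 0] at this
    simp at this
    linarith
  obtain ⟨ρ, σ, u, hρ, hσ, hu, huV, huP⟩ := exists_weights hV hmin
  set R : Matrix (Fin p) (Fin p) ℂ := of fun i j => (ρ * (a j * (a i)ᴴ)).trace with hRdef
  set S : Matrix (Fin p) (Fin p) ℂ := of fun i j => (σ * (b j * (b i)ᴴ)).trace with hSdef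
  -- The value at `P = 1` is at most `V * (tr ρ + tr σ) ≤ u`, while every `P` gives at least `u`; so
  -- `1` is a minimizer.
  have hRS : R = S := by
    refine eq_of_trace_inv_add_trace_minimal (isHermitian_gram hρ.isHermitian a)
      (isHermitian_gram hσ.isHermitian b) fun P hP => ?_
    have h1 := trace_mul_re_le hρ (quad_posSemidef a PosSemidef.one).isHermitian
    have h2 := trace_mul_re_le hσ (quad_posSemidef b PosSemidef.one).isHermitian
    have h3 := huP P hP
    rw [trace_mul_quad, Matrix.mul_one] at h1 h2
    rw [trace_mul_quad, trace_mul_quad] at h3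
    have h4 : 0 ≤ ρ.trace.re := (Complex.le_def.mp hρ.trace_nonneg).1
    have h5 : 0 ≤ σ.trace.re := (Complex.le_def.mp hσ.trace_nonneg).1
    have h6 := mul_le_mul_of_nonneg_right ha h4
    have h7 := mul_le_mul_of_nonneg_right hb h5
    linarith
  have hu2 : u ≤ 2 * R.trace.re := by
    have := huP 1 PosDef.one
    rw [inv_one, trace_mul_quad, trace_mul_quad, Matrix.mul_one, Matrix.mul_one, ← hSdef,
      ← hRdef, ← hRS] at this
    linarith
  obtain ⟨C, hC⟩ := CStarAlgebra.nonneg_iff_eq_star_mul_self.mp hρ.nonneg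
  obtain ⟨D, hD⟩ := CStarAlgebra.nonneg_iff_eq_star_mul_self.mp hσ.nonneg
  rw [star_eq_conjTranspose] at hC hD
  have gram : ∀ (ρ C : Matrix (Fin k) (Fin k) ℂ), ρ = Cᴴ * C →
      ∀ (a : Fin p → Matrix (Fin k) (Fin n) ℂ) (i j : Fin p),
      inner ℂ (conjVec (C * a i)) (conjVec (C * a j)) = (ρ * (a i * (a j)ᴴ)).trace := by
    rintro _ C rfl a i j
    rw [inner_conjVec, conjTranspose_mul, ← Matrix.mul_assoc, trace_mul_comm]
    simp only [Matrix.mul_assoc]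
  obtain ⟨W, hW1, hW⟩ := exists_contraction_of_gram_eq (fun i => conjVec (C * a i))
    (fun i => conjVec (D * b i)) fun i j => by
      rw [gram ρ C hC, gram σ D hD]
      exact congrFun (congrFun hRS j) i
  have hcb : ‖amplification φ k W‖ₑ ≤ cbNorm φ :=
    (le_iSup₂_of_le W hW1 le_rfl).trans
      (le_iSup₂_of_le (f := fun (m : ℕ) (_ : 1 ≤ m) =>
        ⨆ (X : Matrix (Fin m × Fin n) (Fin m × Fin n) ℂ) (_ : ‖X‖ ≤ 1), ‖amplification φ m X‖ₑ)
        k hk le_rfl)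
  refine le_trans ?_ hcb
  rw [← ofReal_norm]
  refine ENNReal.ofReal_le_ofReal ?_
  -- Since `W` carries `conjVec (D * b i)` to `conjVec (C * a i)`, each summand becomes a squared
  -- norm, a diagonal entry of `R`.
  have hval : star (conjVec C).ofLp ⬝ᵥ (amplification φ k W *ᵥ (conjVec D).ofLp) = R.trace := by
    rw [amplification_eq_sum hφ, sum_mulVec, dotProduct_sum]
    simp only [trace, diag_apply]
    refine Finset.sum_congr rfl fun i _ => ?_
    rw [← mulVec_mulVec, ← mulVec_mulVec, kronecker_mulVec_conjVec, hW i, dotProduct_mulVec,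
      show star (conjVec C).ofLp ᵥ* ((1 : Matrix (Fin k) (Fin k) ℂ) ⊗ₖ a i) =
        star (conjVec (C * a i)).ofLp by
          rw [← kronecker_mulVec_conjVec, star_mulVec, conjTranspose_kronecker,
            conjTranspose_one, conjTranspose_conjTranspose], hRdef, of_apply, ← gram ρ C hC,
      EuclideanSpace.inner_eq_star_dotProduct, dotProduct_comm]
  have hle : R.trace.re ≤ ‖amplification φ k W‖ * (√ρ.trace.re * √σ.trace.re) := by
    rw [← hval, hC, hD, ← norm_conjVec, ← norm_conjVec]
    calc _ ≤ ‖star (conjVec C).ofLp ⬝ᵥ (amplification φ k W *ᵥ (conjVec D).ofLp)‖ :=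
          Complex.re_le_norm _
      _ = ‖inner ℂ (conjVec C)
            (WithLp.toLp 2 (amplification φ k W *ᵥ (conjVec D).ofLp))‖ := by
          rw [EuclideanSpace.inner_eq_star_dotProduct, dotProduct_comm]
      _ ≤ ‖conjVec C‖ * (‖amplification φ k W‖ * ‖conjVec D‖) :=
          (norm_inner_le_norm _ _).trans
            (mul_le_mul_of_nonneg_left (l2_opNorm_mulVec _ _) (norm_nonneg _))
      _ = _ := by ring
  have h4 : 0 ≤ ρ.trace.re := (Complex.le_def.mp hρ.trace_nonneg).1
  have h5 : 0 ≤ σ.trace.re := (Complex.le_def.mp hσ.trace_nonneg).1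
  have hamgm : 2 * (√ρ.trace.re * √σ.trace.re) ≤ ρ.trace.re + σ.trace.re := by
    nlinarith [sq_nonneg (√ρ.trace.re - √σ.trace.re), Real.sq_sqrt h4, Real.sq_sqrt h5]
  have hN := norm_nonneg (amplification φ k W)
  -- Combines `u ≤ 2 tr R`, Cauchy–Schwarz and AM–GM; the common factor `tr ρ + tr σ` then cancels
  -- against `huV`.
  have h6 : u ≤ ‖amplification φ k W‖ * (ρ.trace.re + σ.trace.re) := by
    nlinarith [mul_le_mul_of_nonneg_left hamgm hN]
  have h7 : 0 < ρ.trace.re + σ.trace.re := by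
    by_contra h
    nlinarith
  exact le_of_mul_le_mul_right (huV.trans h6) h7

/-! ### Change of representation and the optimal `S` -/

lemma sum_tmul_eq_sum_mix
    {E : Fin p → Matrix (Fin k) (Fin n) ℂ} {F : Fin p → Matrix (Fin n) (Fin k) ℂ}
    {S T : Matrix (Fin p) (Fin p) ℂ} (hTS : T * S = 1) :
    ∑ i, E i ⊗ₜ[ℂ] F i = ∑ i, rightMix E T i ⊗ₜ[ℂ] leftMix S F i := by
  have h : ∀ i j, ∑ r, T i r * S r j = if i = j then 1 else 0 := fun i j => by
    rw [← mul_apply, hTS, one_apply]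
  simp only [rightMix, leftMix, TensorProduct.sum_tmul, TensorProduct.tmul_sum,
    TensorProduct.smul_tmul_smul]
  calc _ = ∑ i, ∑ j, (∑ r, T i r * S r j) • (E i ⊗ₜ[ℂ] F j) := by simp [h]
    _ = ∑ i, ∑ j, ∑ r, (T i r * S r j) • (E i ⊗ₜ[ℂ] F j) := by simp only [Finset.sum_smul]
    _ = ∑ i, ∑ r, ∑ j, (T i r * S r j) • (E i ⊗ₜ[ℂ] F j) :=
        Finset.sum_congr rfl fun _ _ => Finset.sum_comm
    _ = ∑ r, ∑ i, ∑ j, (T i r * S r j) • (E i ⊗ₜ[ℂ] F j) := Finset.sum_comm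
    _ = ∑ r, ∑ j, ∑ i, (T i r * S r j) • (E i ⊗ₜ[ℂ] F j) :=
        Finset.sum_congr rfl fun _ _ => Finset.sum_comm

lemma linearIndependent_conjTranspose {F : Fin p → Matrix (Fin n) (Fin k) ℂ}
    (hF : LinearIndependent ℂ F) : LinearIndependent ℂ fun i => (F i)ᴴ := by
  rw [Fintype.linearIndependent_iff] at hF ⊢
  intro c hc i
  have := hF (fun i => star (c i)) (by
    have := congrArg conjTranspose hc
    simpa [conjTranspose_sum, conjTranspose_smul] using this) i
  simpa using this

lemma conjTranspose_leftMix (S : Matrix (Fin p) (Fin p) ℂ)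
    (F : Fin p → Matrix (Fin n) (Fin k) ℂ) (i : Fin p) :
    (leftMix S F i)ᴴ = rightMix (fun i => (F i)ᴴ) Sᴴ i := by
  simp [leftMix, rightMix, conjTranspose_sum, conjTranspose_smul]

lemma quad_rightMix_eq (a : Fin p → Matrix (Fin k) (Fin n) ℂ) (T Q : Matrix (Fin p) (Fin p) ℂ) :
    quad (rightMix a T) Q = quad a (T * Q * Tᴴ) :=
  quad_rightMix a T Q

lemma exists_posDef_cost_le_cbNorm {φ : Matrix (Fin n) (Fin n) ℂ →ₗ[ℂ] Matrix (Fin k) (Fin k) ℂ}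
    {E : Fin p → Matrix (Fin k) (Fin n) ℂ} {F : Fin p → Matrix (Fin n) (Fin k) ℂ}
    (hφ : IsChoiKraus φ E F) (hE : LinearIndependent ℂ E) (hF : LinearIndependent ℂ F) :
    ∃ S : Matrix (Fin p) (Fin p) ℂ, S.PosDef ∧
      cost (rightMix E S⁻¹) (leftMix S F) ≤ cbNorm φ := by
  obtain ⟨P, hP, hmin⟩ := exists_posDef_minimizer hE (linearIndependent_conjTranspose hF)
  obtain ⟨S, hS, rfl⟩ : ∃ S : Matrix (Fin p) (Fin p) ℂ, S.PosDef ∧ P = S * S := by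
    refine ⟨CFC.sqrt P, ?_, (CFC.sqrt_mul_sqrt_self P hP.posSemidef.nonneg).symm⟩
    have h0 : (CFC.sqrt P).PosSemidef := (CFC.sqrt_nonneg P).posSemidef
    refine h0.posDef_iff_isUnit.mpr ?_
    have h1 := hP.isUnit
    rw [← CFC.sqrt_mul_sqrt_self P hP.posSemidef.nonneg] at h1
    exact isUnit_of_mul_isUnit_left h1
  have hSH := hS.isHermitian.eq
  have hdet := (isUnit_iff_isUnit_det _).mp hS.isUnit
  have hSiH : (S⁻¹)ᴴ = S⁻¹ := hS.inv.isHermitian.eq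
  set a := rightMix E S⁻¹ with ha
  set b := rightMix (fun i => (F i)ᴴ) S with hb
  have hbF : ∀ i, (b i)ᴴ = leftMix S F i := by
    intro i
    have := conjTranspose_leftMix S F i
    rw [hSH] at this
    rw [hb, ← this, conjTranspose_conjTranspose]
  have hab : IsChoiKraus φ a fun i => (b i)ᴴ := by
    simp only [hbF]
    exact isChoiKraus_of_tensor_eq hφ (sum_tmul_eq_sum_mix (nonsing_inv_mul _ hdet))
  have hqa : ∀ Q, quad a Q = quad E (S⁻¹ * Q * S⁻¹) := fun Q => by
    rw [ha, quad_rightMix_eq, hSiH]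
  have hqb : ∀ Q, quad b Q = quad (fun i => (F i)ᴴ) (S * Q * S) := fun Q => by
    rw [hb, quad_rightMix_eq, hSH]
  set V := max ‖quad a 1‖ ‖quad b 1‖ with hV
  -- The substitution `P' ↦ S * P' * S` turns optimality of `S * S` for the original families into
  -- optimality of `1` for the mixed ones.
  have hle := ofReal_le_cbNorm hab (le_max_left _ _) (le_max_right _ _) fun P' hP' => by
    have h1 : (S * P' * S).PosDef := by
      have := (IsUnit.posDef_star_right_conjugate_iff (x := P') hS.isUnit).mpr hP'
      rwa [star_eq_conjTranspose, hSH] at this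
    have h2 := hmin _ h1
    rw [Matrix.mul_inv_rev, Matrix.mul_inv_rev, Matrix.mul_inv_rev, ← Matrix.mul_assoc] at h2
    rw [hqa, hqb, hqa, hqb, Matrix.mul_one, Matrix.mul_one]
    exact h2
  refine ⟨S, hS, le_trans ?_ hle⟩
  have hb1 : ∑ i, (leftMix S F i)ᴴ * leftMix S F i = quad b 1 := by
    simp only [← hbF, conjTranspose_conjTranspose, quad_one]
  rw [cost_eq_ofReal, ← quad_one, hb1]
  refine ENNReal.ofReal_le_ofReal ?_
  have hV0 : 0 ≤ V := (norm_nonneg _).trans (le_max_left _ _)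
  calc _ ≤ √V * √V := mul_le_mul (Real.sqrt_le_sqrt (le_max_left _ _))
        (Real.sqrt_le_sqrt (le_max_right _ _)) (Real.sqrt_nonneg _) (Real.sqrt_nonneg _)
    _ = V := Real.mul_self_sqrt hV0

end CBNorm

/-! ### Assembly of the theorem -/

theorem mainTheorem2 (n k : ℕ)
    (φ : Matrix (Fin n) (Fin n) ℂ →ₗ[ℂ] Matrix (Fin k) (Fin k) ℂ) :
    -- eliminating dependencies yields a representation with linearly independent families
    (∀ (m p : ℕ) (A : Fin m → Matrix (Fin k) (Fin n) ℂ) (B : Fin m → Matrix (Fin n) (Fin k) ℂ)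
      (E : Fin p → Matrix (Fin k) (Fin n) ℂ) (F : Fin p → Matrix (Fin n) (Fin k) ℂ),
      CBNorm.IsChoiKraus φ A B → CBNorm.IsReduction A B E F →
        CBNorm.IsChoiKraus φ E F ∧ LinearIndependent ℂ E ∧ LinearIndependent ℂ F) ∧
    -- the norm formula for every representation with linearly independent families
    (∀ (p : ℕ) (E : Fin p → Matrix (Fin k) (Fin n) ℂ) (F : Fin p → Matrix (Fin n) (Fin k) ℂ),
      CBNorm.IsChoiKraus φ E F → LinearIndependent ℂ E → LinearIndependent ℂ F →
        CBNorm.cbNorm φ = (⨅ (S : Matrix (Fin p) (Fin p) ℂ) (_ : IsUnit S),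
          CBNorm.cost (CBNorm.rightMix E S⁻¹) (CBNorm.leftMix S F)) ∧
        CBNorm.cbNorm φ = (⨅ (S : Matrix (Fin p) (Fin p) ℂ) (_ : S.PosDef),
          CBNorm.cost (CBNorm.rightMix E S⁻¹) (CBNorm.leftMix S F)) ∧
        CBNorm.haagerupNorm (∑ i, E i ⊗ₜ[ℂ] F i) = CBNorm.cbNorm φ ∧
        -- `p` is the least length of a representation of the tensor
        IsLeast {r : ℕ | ∃ (A : Fin r → Matrix (Fin k) (Fin n) ℂ)
          (B : Fin r → Matrix (Fin n) (Fin k) ℂ),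
          ∑ i, E i ⊗ₜ[ℂ] F i = ∑ i, A i ⊗ₜ[ℂ] B i} p ∧
        -- the Haagerup norm is attained at a representation of that length
        ∃ S : Matrix (Fin p) (Fin p) ℂ, S.PosDef ∧
          ∑ i, E i ⊗ₜ[ℂ] F i
            = ∑ i, CBNorm.rightMix E S⁻¹ i ⊗ₜ[ℂ] CBNorm.leftMix S F i ∧
          CBNorm.cost (CBNorm.rightMix E S⁻¹) (CBNorm.leftMix S F)
            = CBNorm.haagerupNorm (∑ i, E i ⊗ₜ[ℂ] F i)) := by
  refine ⟨fun m p A B E F h hr => hr.isChoiKraus_linearIndependent h,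
    fun p E F hφ hE hF => ?_⟩
  have hmix : ∀ S : Matrix (Fin p) (Fin p) ℂ, IsUnit S → ∑ i, E i ⊗ₜ[ℂ] F i =
      ∑ i, CBNorm.rightMix E S⁻¹ i ⊗ₜ[ℂ] CBNorm.leftMix S F i := fun S hS =>
    CBNorm.sum_tmul_eq_sum_mix (Matrix.nonsing_inv_mul _ ((Matrix.isUnit_iff_isUnit_det _).mp hS))
  have hle : ∀ S : Matrix (Fin p) (Fin p) ℂ, IsUnit S →
      CBNorm.cbNorm φ ≤ CBNorm.cost (CBNorm.rightMix E S⁻¹) (CBNorm.leftMix S F) := fun S hS =>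
    CBNorm.cbNorm_le_cost (CBNorm.isChoiKraus_of_tensor_eq hφ (hmix S hS))
  obtain ⟨S, hS, hcost⟩ := CBNorm.exists_posDef_cost_le_cbNorm hφ hE hF
  have hh : CBNorm.haagerupNorm (∑ i, E i ⊗ₜ[ℂ] F i) = CBNorm.cbNorm φ := by
    refine le_antisymm ?_ ?_
    · exact (iInf₂_le_of_le p (CBNorm.rightMix E S⁻¹) (iInf₂_le (CBNorm.leftMix S F)
        (hmix S hS.isUnit))).trans hcost
    · exact le_iInf₂ fun m A => le_iInf₂ fun B hu =>
        CBNorm.cbNorm_le_cost (CBNorm.isChoiKraus_of_tensor_eq hφ hu)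
  refine ⟨le_antisymm (le_iInf₂ hle) (iInf₂_le_of_le S hS.isUnit hcost),
    le_antisymm (le_iInf₂ fun S hS => hle S hS.isUnit) (iInf₂_le_of_le S hS hcost), hh,
    ⟨⟨E, F, rfl⟩, fun r ⟨A, B, hu⟩ => CBNorm.card_le_of_tensor_eq hE hF hu⟩,
    S, hS, hmix S hS.isUnit, ?_⟩
  rw [hh]
  exact le_antisymm hcost (hle S hS.isUnit)
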